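/- **Theorem 1.2.** Let $C\subseteq\mathbb F_2^n$ be a binary linear code with minimum distance $d$ that contains the all-ones vector $\mathbf 1_n$, and let $d^\perp$ be the minimum distance of its dual code $C^\perp=\{y\in\mathbb F_2^n \mid \sum_{i} x_iy_i=0 \text{ for all } x\in C\}$. For an integer $t$ with $0<t<d^\perp$, say that $C$ is *applicable to the Assmus–Mattson theorem* with $(d^\perp,t)$ if $$d^\perp-t=\#\{u \mid 0<u\le n-t,\ C \text{ has a codeword of weight } u\}.$$ For $m\ge 1$ let $D^\perp_m$ be the support design of $C^\perp$ for the weight $m$: its points are the $n$ coordinates and its blocks are the supports of the codewords of weight $m$ in $C^\perp$. A collection of $m$-element blocks is a $t$-design if the number of blocks containing a given set of $t$ points is the same for all $t$-element sets of points; the empty collection is allowed. Let $w\ge 0$ be an integer. (1) Let $C$ be applicable to the Assmus–Mattson theorem with $(d^\perp,t)=(4,2)$. If $$\sum_{i=0}^{w}(-1)^{w-i}\binom{d-3}{w-i}\binom{n-2d}{2i+1}=0,$$ then $D^\perp_{2w+4}$ is a $3$-design. (2) Let $C$ be applicable to the Assmus–Mattson theorem with $(d^\perp,t)=(4,1)$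 or $(6,3)$. If $$\left(\sum_{i=0}^{w}(-1)^{w-i}\binom{d-(t+1)}{w-i}\binom{n-2d}{2i}\right)+(-1)^{w+1}\binom{n/2-(t+1)}{w}=0,$$ then $D^\perp_{2w+t+1}$ is a $(t+1)$-design. Here $\binom{x}{j}=x(x-1)\cdots(x-j+1)/j!$. -/

import Mathlib

/-- A binary linear code of length `n`: a subspace of `𝔽₂ⁿ`. -/
abbrev BinaryCode (n : ℕ) := Submodule (ZMod 2) (Fin n → ZMod 2)

namespace BinaryCode

/-- The dual code `C^⊥ = {y | (x, y) = 0 for all x ∈ C}`, where `(x, y) = ∑ i, x i * y i`. -/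
def dual {n : ℕ} (C : BinaryCode n) : BinaryCode n where
  carrier := {y | ∀ x ∈ C, ∑ i, x i * y i = 0}
  zero_mem' := by
    intro x _
    simp
  add_mem' := by
    intro y z hy hz x hx
    simp only [Pi.add_apply, mul_add, Finset.sum_add_distrib, hy x hx, hz x hx, add_zero]
  smul_mem' := by
    intro a y hy x hx
    simp only [Pi.smul_apply, smul_eq_mul, mul_left_comm _ a, ← Finset.mul_sum, hy x hx, mul_zero]

/-- The minimum distance of `C` (the least weight of a nonzero codeword) exists and equals `d`.
The weight of a vector is its Hamming norm. -/
def HasMinDist {n : ℕ} (C : BinaryCode n) (d : ℕ) : Prop :=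
  IsLeast {u : ℕ | ∃ c ∈ C, c ≠ 0 ∧ hammingNorm c = u} d

/-- The support of a vector: the set of indices of its nonzero coordinates. -/
def supp {n : ℕ} (c : Fin n → ZMod 2) : Finset (Fin n) :=
  {i | c i ≠ 0}

/-- The blocks of the support design of `C` for the weight `w`: the supports of all codewords
of weight `w`. (Distinct binary words have distinct supports, so there are no repeated blocks.) -/
def supportDesign {n : ℕ} (C : BinaryCode n) (w : ℕ) : Set (Finset (Fin n)) :=
  {B | ∃ c ∈ C, hammingNorm c = w ∧ supp c = B}

/-- `C` is applicable to the Assmus–Mattson theorem with parameters `(d^⊥, t)`: it contains the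
all-ones word, its dual has minimum distance `d^⊥`, `0 < t < d^⊥`, and `d^⊥ - t` is the number
of weights `u` of codewords with `0 < u ≤ n - t`. -/
structure AssmusMattson {n : ℕ} (C : BinaryCode n) (dperp t : ℕ) : Prop where
  one_mem : (fun _ => 1) ∈ C
  dual_minDist : C.dual.HasMinDist dperp
  t_pos : 0 < t
  t_lt : t < dperp
  card_weights : (dperp : ℤ) - t =
    ({u : ℕ | 0 < u ∧ (u : ℤ) ≤ (n : ℤ) - t ∧ ∃ c ∈ C, hammingNorm c = u}.ncard : ℤ)

end BinaryCode

/-- The collection `𝓑` of subsets of the `v`-point set `Fin v` is the collection of blocks of a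
`t`-`(v, k, l)` design for some `l`: all blocks have `k` points, and any `t` points are contained
in precisely `l` blocks. The empty collection is allowed (with `l = 0`). -/
def IsDesign {v : ℕ} (t k : ℕ) (𝓑 : Set (Finset (Fin v))) : Prop :=
  (∀ B ∈ 𝓑, B.card = k) ∧
    ∃ l : ℕ, ∀ T : Finset (Fin v), T.card = t → {B ∈ 𝓑 | T ⊆ B}.ncard = l

section

open Polynomial Finset

/-! Compare two sets T, T' of t+1 points, and let ε_u be the difference of the numbers of codewords
of C of weight u vanishing on T and on T' (`vanishCount`). Since C is an orthogonal array of
strength d^⊥ - 1, power moments of ε vanish; on sets of at most t points they force the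
Assmus–Mattson conclusion. MacWilliams duality turns the enumerator of dual words covering T into a
sum over subsets R of T. All terms with R ≠ T agree for T and T', so up to a nonzero constant the
difference of the two enumerators is X^(t+1) Σ ε_u (1-X)^u (1+X)^(n-u) / (1-X²)^(t+1)
(`blockPoly_dual_sub`). Adding the all-ones word gives ε_{n-u} = (-1)^(t+1) ε_u, so ε lives on the
weights with t < u < n-t. If there are fewer than d^⊥ - t of them, the moments kill ε and every
weight gives a design. Otherwise they are {d, n-d} or {d, n/2, n-d}; the symmetry and, for three
weights, Σ ε_u = 0 determine ε up to the scalar ε_d. The assumed identity says that the relevant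
coefficient of the resulting explicit polynomial is zero. -/

/-- The nontrivial additive character of `𝔽₂`, with values in `ℚ`. -/
def signChar : AddChar (ZMod 2) ℚ where
  toFun a := if a = 0 then 1 else -1
  map_zero_eq_one' := if_pos rfl
  map_add_eq_mul' := by
    intro a b
    fin_cases a <;> fin_cases b <;> simp <;> decide

theorem signChar_apply (a : ZMod 2) : signChar a = if a = 0 then 1 else -1 := rfl

theorem ZMod.two_eq_zero_or_one (a : ZMod 2) : a = 0 ∨ a = 1 := by
  fin_cases a
  · exact Or.inl rfl
  · exact Or.inr rfl

/-! ### Characters, orthogonal arrays and moments. -/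

namespace BinaryCode

variable {n : ℕ}

open Classical in
/-- The finite set of codewords of `C`. -/
noncomputable def words (C : BinaryCode n) : Finset (Fin n → ZMod 2) := {c | c ∈ C}

@[simp] theorem mem_words {C : BinaryCode n} {c : Fin n → ZMod 2} : c ∈ C.words ↔ c ∈ C := by
  simp [words]

theorem card_words_ne_zero (C : BinaryCode n) : (#C.words : ℚ) ≠ 0 :=
  Nat.cast_ne_zero.2 (card_ne_zero.2 ⟨0, mem_words.2 C.zero_mem⟩)

open Classical in
/-- Orthogonality of characters on a binary code. -/
theorem sum_words_signChar (C : BinaryCode n) (y : Fin n → ZMod 2) :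
    ∑ c ∈ C.words, ∏ i, signChar (c i * y i) = if y ∈ C.dual then (#C.words : ℚ) else 0 := by
  have hprod : ∀ c : Fin n → ZMod 2,
      ∏ i, signChar (c i * y i) = signChar (∑ i, c i * y i) := fun c =>
    (map_prod signChar.toMonoidHom (fun i => Multiplicative.ofAdd (c i * y i)) univ).symm
  simp only [hprod]
  split_ifs with h
  · rw [sum_congr rfl fun c hc => by rw [h c (mem_words.1 hc), signChar.map_zero_eq_one]]
    simp
  · obtain ⟨x, hx, hxy⟩ : ∃ x ∈ C, ∑ i, x i * y i ≠ 0 := by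
      by_contra! hcon
      exact h hcon
    -- Translation by a codeword not orthogonal to y permutes C and flips every sign.
    have key : ∑ c ∈ C.words, signChar (∑ i, c i * y i)
        = ∑ c ∈ C.words, -signChar (∑ i, c i * y i) := by
      refine sum_bij' (fun c _ => c + x) (fun c _ => c - x) ?_ ?_ ?_ ?_ ?_
      · intro c hc
        exact mem_words.2 (C.add_mem (mem_words.1 hc) hx)
      · intro c hc
        exact mem_words.2 (C.sub_mem (mem_words.1 hc) hx)
      · intro c _
        simp
      · intro c _
        simp
      · intro c _
        simp only [Pi.add_apply, add_mul, sum_add_distrib, AddChar.map_add_eq_mul]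
        rw [signChar_apply (∑ i, x i * y i), if_neg hxy]
        ring
    rw [sum_neg_distrib] at key
    linarith

/-- The number of codewords of weight `u` that vanish on `S`. -/
noncomputable def vanishCount (C : BinaryCode n) (u : ℕ) (S : Finset (Fin n)) : ℚ :=
  #{c ∈ C.words | hammingNorm c = u ∧ ∀ i ∈ S, c i = 0}

theorem ite_forall_eq_zero (S : Finset (Fin n)) (c : Fin n → ZMod 2) :
    (if ∀ i ∈ S, c i = 0 then (1 : ℚ) else 0) = ∏ i ∈ S, if c i = 0 then (1 : ℚ) else 0 := by
  rw [prod_ite_zero]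
  simp

theorem hammingNorm_le (c : Fin n → ZMod 2) : hammingNorm c ≤ n := by
  simpa using hammingNorm_le_card_fintype (x := c)

/-- Grouping a sum over the codewords vanishing on `S` by weight. -/
theorem sum_vanishCount_smul {M : Type*} [AddCommGroup M] [Module ℚ M] (C : BinaryCode n)
    (S : Finset (Fin n)) (f : ℕ → M) :
    ∑ u ∈ range (n + 1), C.vanishCount u S • f u =
      ∑ c ∈ C.words, if ∀ i ∈ S, c i = 0 then f (hammingNorm c) else 0 := by
  rw [← sum_fiberwise_of_maps_to (s := C.words) (t := range (n + 1)) (g := fun c => hammingNorm c)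
    (fun c _ => mem_range.2 (Nat.lt_succ_of_le (hammingNorm_le c)))]
  refine sum_congr rfl fun u _ => ?_
  rw [← sum_filter, filter_filter, vanishCount, Nat.cast_smul_eq_nsmul, ← sum_const]
  exact sum_congr rfl fun c hc => by rw [(mem_filter.1 hc).2.1]

/-- A code with dual distance `d'` is an orthogonal array of strength `d' - 1`. -/
theorem sum_vanish_of_card_lt {C : BinaryCode n} {d' : ℕ} (hd : C.dual.HasMinDist d')
    {S : Finset (Fin n)} (hS : #S < d') :
    ∑ c ∈ C.words, (if ∀ i ∈ S, c i = 0 then (1 : ℚ) else 0) = #C.words / 2 ^ #S := by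
  -- The indicator of c_i = 0 is (1 + χ(c_i))/2; expand the product over S.
  have h1 : ∀ c : Fin n → ZMod 2, (if ∀ i ∈ S, c i = 0 then (1 : ℚ) else 0)
      = ∑ R ∈ S.powerset,
        (∏ i, signChar (c i * if i ∈ R then 1 else 0)) / 2 ^ #S := by
    intro c
    rw [ite_forall_eq_zero, ← sum_div, eq_div_iff (by positivity), ← prod_const, ← prod_mul_distrib]
    have : ∀ i ∈ S, (if c i = 0 then (1 : ℚ) else 0) * 2 = signChar (c i) + 1 := by
      intro i _
      rw [signChar_apply]
      split_ifs <;> norm_num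
    rw [prod_congr rfl this, prod_add_one]
    refine sum_congr rfl fun R _ => ?_
    rw [← prod_subset (subset_univ R)]
    · exact prod_congr rfl fun i hi => by rw [if_pos hi, mul_one]
    · intro i _ hi
      rw [if_neg hi, mul_zero, AddChar.map_zero_eq_one]
  rw [sum_congr rfl fun c _ => h1 c, sum_comm, sum_eq_single ∅]
  · simp [div_eq_mul_inv]
  · intro R hR hne
    -- For R nonempty, its indicator vector is too light to be a dual word.
    rw [← sum_div, sum_words_signChar, if_neg, zero_div]
    intro hmem
    have hle : d' ≤ #R := by
      refine hd.2 ⟨_, hmem, ?_, ?_⟩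
      · intro h0
        obtain ⟨i, hi⟩ := nonempty_iff_ne_empty.2 hne
        simpa [hi] using congrFun h0 i
      · simp [hammingNorm]
    exact absurd (card_le_card (mem_powerset.1 hR)) (by omega)
  · simp

/-- The power moments of the weights of the codewords vanishing on `S` depend on `#S` only. -/
theorem sum_vanish_mul_pow_eq {C : BinaryCode n} {d' : ℕ} (hd : C.dual.HasMinDist d') (k : ℕ) :
    ∀ {S S' : Finset (Fin n)}, #S = #S' → #S + k < d' →
    ∑ c ∈ C.words, (if ∀ i ∈ S, c i = 0 then ((n : ℚ) - hammingNorm c) ^ k else 0) =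
    ∑ c ∈ C.words, (if ∀ i ∈ S', c i = 0 then ((n : ℚ) - hammingNorm c) ^ k else 0) := by
  suffices h : ∀ s, s + k < d' → ∃ q : ℚ, ∀ S : Finset (Fin n), #S = s →
      ∑ c ∈ C.words, (if ∀ i ∈ S, c i = 0 then ((n : ℚ) - hammingNorm c) ^ k else 0) = q by
    intro S S' hSS hk
    obtain ⟨q, hq⟩ := h _ hk
    rw [hq S rfl, hq S' hSS.symm]
  induction k with
  | zero =>
    intro s hs
    refine ⟨#C.words / 2 ^ s, fun S hS => ?_⟩
    simp only [pow_zero]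
    rw [sum_vanish_of_card_lt hd (by omega), hS]
  | succ k ih =>
    intro s hs
    obtain ⟨q, hq⟩ := ih s (by omega)
    obtain ⟨q', hq'⟩ := ih (s + 1) (by omega)
    refine ⟨s * q + ((n : ℚ) - s) * q', fun S hS => ?_⟩
    -- One factor n - wt(c) counts the zeros i of c; each i either lies in S or enlarges S by one
    -- point.
    have h1 : ∀ c : Fin n → ZMod 2,
        (if ∀ i ∈ S, c i = 0 then ((n : ℚ) - hammingNorm c) ^ (k + 1) else 0) =
        ∑ i, if ∀ j ∈ insert i S, c j = 0 then ((n : ℚ) - hammingNorm c) ^ k else 0 := by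
      intro c
      have hz : (n : ℚ) - hammingNorm c = ∑ i, if c i = 0 then (1 : ℚ) else 0 := by
        have := card_filter_add_card_filter_not (s := (univ : Finset (Fin n))) (fun i => c i = 0)
        rw [card_univ, Fintype.card_fin] at this
        rw [sum_boole, hammingNorm, sub_eq_iff_eq_add]
        exact_mod_cast this.symm
      simp only [forall_mem_insert]
      by_cases hc : ∀ i ∈ S, c i = 0
      · simp only [if_pos hc, and_iff_left hc]
        rw [pow_succ']
        nth_rw 1 [hz]
        rw [sum_mul]
        exact sum_congr rfl fun i _ => by split_ifs <;> simp
      · simp [hc]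
    rw [sum_congr rfl fun c _ => h1 c, sum_comm, ← sum_add_sum_compl S]
    rw [sum_congr rfl fun i hi => by rw [insert_eq_of_mem hi, hq S hS],
      sum_congr (s₁ := Sᶜ) rfl fun i hi =>
        hq' _ (by rw [card_insert_of_notMem (mem_compl.1 hi), hS])]
    rw [sum_const, sum_const, card_compl, hS, Fintype.card_fin, nsmul_eq_mul, nsmul_eq_mul,
      Nat.cast_sub (hS ▸ (by simpa using card_le_univ S))]

end BinaryCode

/-! ### The Assmus–Mattson theorem and complementation. -/

/-- A rational function on a finite set of naturals is zero if sufficiently many of its power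
moments vanish. -/
theorem eq_zero_of_sum_mul_pow_eq_zero (W : Finset ℕ) (b : ℕ → ℚ) (a : ℚ)
    (h : ∀ k < #W, ∑ u ∈ W, b u * (a - u) ^ k = 0) : ∀ u ∈ W, b u = 0 := by
  intro v hv
  -- Lagrange interpolation: p vanishes at every node except that of v.
  set p : ℚ[X] := ∏ x ∈ W.erase v, (X - C (a - x)) with hp
  have hdeg : p.natDegree < #W := by
    rw [hp, natDegree_prod_of_monic _ _ fun i _ => monic_X_sub_C _]
    simp only [natDegree_X_sub_C, sum_const, smul_eq_mul, mul_one]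
    exact card_erase_lt_of_mem hv
  have hsum : ∑ u ∈ W, b u * p.eval (a - u) = 0 := by
    simp only [eval_eq_sum_range' hdeg, mul_sum]
    rw [sum_comm]
    refine sum_eq_zero fun k hk => ?_
    rw [← mul_zero (p.coeff k), ← h k (mem_range.1 hk), mul_sum]
    exact sum_congr rfl fun u _ => by ring
  rw [sum_eq_single_of_mem v hv] at hsum
  · refine (mul_eq_zero.1 hsum).resolve_right ?_
    rw [hp, eval_prod]
    refine prod_ne_zero_iff.2 ?_
    intro x hx
    have hxv : (x : ℚ) ≠ v := by exact_mod_cast (mem_erase.1 hx).1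
    simp only [eval_sub, eval_X, eval_C]
    intro h0
    exact hxv (by linarith)
  · intro x hx hxv
    rw [hp, eval_prod, prod_eq_zero (mem_erase.2 ⟨hxv, hx⟩) (by simp), mul_zero]

/-- If `F` depends only on the cardinality for sets of at most `t` elements, then sums of `F`
over the subsets of two sets of `t + 1` elements differ by the top terms only. -/
theorem sum_powerset_sub_sum_powerset {α A : Type*} [AddCommGroup A] {t : ℕ}
    (F : Finset α → A) (hF : ∀ R R' : Finset α, #R = #R' → #R ≤ t → F R = F R')
    {T T' : Finset α} (hT : #T = t + 1) (hT' : #T' = t + 1) :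
    ∑ R ∈ T.powerset, F R - ∑ R ∈ T'.powerset, F R = F T - F T' := by
  classical
  obtain ⟨G, hG⟩ : ∃ G : ℕ → A, ∀ R : Finset α, #R ≤ t → F R = G #R := by
    refine ⟨fun s => if h : ∃ R : Finset α, #R = s then F h.choose else 0, fun R hR => ?_⟩
    have h : ∃ R' : Finset α, #R' = #R := ⟨R, rfl⟩
    simp only [dif_pos h]
    exact hF _ _ h.choose_spec.symm hR
  have key : ∀ T : Finset α, #T = t + 1 → ∑ R ∈ T.powerset, F R
      = ∑ m ∈ range (t + 1 + 1), (t + 1).choose m • G m + (F T - G (t + 1)) := by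
    intro T hT
    rw [← hT, ← sum_powerset_apply_card, ← sub_eq_iff_eq_add', ← sum_sub_distrib]
    refine sum_eq_single_of_mem T (mem_powerset_self T) fun R hR hne => ?_
    have hlt := card_lt_card ((mem_powerset.1 hR).ssubset_of_ne hne)
    rw [hG R (by omega), sub_self]
  rw [key T hT, key T' hT']
  abel

namespace BinaryCode

variable {n : ℕ}

/-- The set of weights of the codewords of `C`. -/
noncomputable def weights (C : BinaryCode n) : Finset ℕ := C.words.image fun c => hammingNorm c

theorem mem_weights {C : BinaryCode n} {u : ℕ} : u ∈ C.weights ↔ ∃ c ∈ C, hammingNorm c = u := by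
  simp [weights]

theorem weights_le {C : BinaryCode n} {u : ℕ} (hu : u ∈ C.weights) : u ≤ n := by
  obtain ⟨c, -, rfl⟩ := mem_weights.1 hu
  exact hammingNorm_le c

theorem vanishCount_eq_zero_of_notMem {C : BinaryCode n} {u : ℕ} (S : Finset (Fin n))
    (hu : u ∉ C.weights) : C.vanishCount u S = 0 := by
  rw [vanishCount, Nat.cast_eq_zero, card_eq_zero, filter_eq_empty_iff]
  intro c hc h
  exact hu (mem_weights.2 ⟨c, mem_words.1 hc, h.1⟩)

theorem vanishCount_eq_zero_of_lt {C : BinaryCode n} {u : ℕ} {S : Finset (Fin n)}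
    (hu : n < u + #S) : C.vanishCount u S = 0 := by
  rw [vanishCount, Nat.cast_eq_zero, card_eq_zero, filter_eq_empty_iff]
  rintro c hc ⟨rfl, hS⟩
  have hdisj : Disjoint ({i | c i ≠ 0} : Finset (Fin n)) S :=
    disjoint_left.2 fun i hi hiS => (mem_filter.1 hi).2 (hS i hiS)
  have h1 := card_le_univ (({i | c i ≠ 0} : Finset (Fin n)) ∪ S)
  rw [card_union_of_disjoint hdisj, Fintype.card_fin] at h1
  exact absurd h1 (not_le.2 hu)

theorem vanishCount_zero (C : BinaryCode n) (S : Finset (Fin n)) : C.vanishCount 0 S = 1 := by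
  rw [vanishCount, Nat.cast_eq_one, card_eq_one]
  refine ⟨0, ?_⟩
  ext c
  simp only [mem_filter, mem_words, hammingNorm_eq_zero, mem_singleton]
  constructor
  · exact fun h => h.2.1
  · rintro rfl
    exact ⟨C.zero_mem, rfl, fun _ _ => rfl⟩

theorem sum_vanishCount_sub_mul_pow {C : BinaryCode n} {d' : ℕ} (hd : C.dual.HasMinDist d')
    {S S' : Finset (Fin n)} (hS : #S = #S') {k : ℕ} (hk : #S + k < d') :
    ∑ u ∈ range (n + 1), (C.vanishCount u S - C.vanishCount u S') * ((n : ℚ) - u) ^ k = 0 := by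
  simp only [sub_mul, sum_sub_distrib]
  have h := C.sum_vanishCount_smul S (fun u => ((n : ℚ) - u) ^ k)
  have h' := C.sum_vanishCount_smul S' (fun u => ((n : ℚ) - u) ^ k)
  simp only [smul_eq_mul] at h h'
  rw [h, h', sum_vanish_mul_pow_eq hd k hS hk, sub_self]

/-- If few weights are available, the numbers of codewords of given weight vanishing on a set
depend only on the size of this set. -/
theorem vanishCount_eq_of_card_le {C : BinaryCode n} {d' : ℕ} (hd : C.dual.HasMinDist d')
    {S S' : Finset (Fin n)} (hS : #S = #S') (W : Finset ℕ) (hW : #W + #S ≤ d')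
    (hsupp : ∀ u, u ∉ W → C.vanishCount u S = C.vanishCount u S') (u : ℕ) :
    C.vanishCount u S = C.vanishCount u S' := by
  by_cases hu : u ∈ W
  · by_cases hun : u ≤ n
    · refine sub_eq_zero.1 (eq_zero_of_sum_mul_pow_eq_zero (W.filter (· ≤ n))
        (fun u => C.vanishCount u S - C.vanishCount u S') n ?_ u (mem_filter.2 ⟨hu, hun⟩))
      intro k hk
      have hk' : k < #W := hk.trans_le (card_filter_le _ _)
      rw [← sum_vanishCount_sub_mul_pow hd hS (k := k) (by omega)]
      refine sum_subset (fun v hv => mem_range.2 (Nat.lt_succ_of_le (mem_filter.1 hv).2)) ?_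
      intro v hv hvW
      have : v ∉ W := fun h => hvW (mem_filter.2 ⟨h, Nat.lt_succ_iff.1 (mem_range.1 hv)⟩)
      rw [hsupp v this, sub_self, zero_mul]
    · rw [vanishCount_eq_zero_of_lt (by omega), vanishCount_eq_zero_of_lt (by omega)]
  · exact hsupp u hu

theorem AssmusMattson.card_filter_weights {C : BinaryCode n} {d' t : ℕ}
    (hC : C.AssmusMattson d' t) : #{u ∈ C.weights | 0 < u ∧ u + t ≤ n} + t = d' := by
  have h := hC.card_weights
  have hset : {u : ℕ | 0 < u ∧ (u : ℤ) ≤ (n : ℤ) - t ∧ ∃ c ∈ C, hammingNorm c = u}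
      = ({u ∈ C.weights | 0 < u ∧ u + t ≤ n} : Finset ℕ) := by
    ext u
    simp only [Set.mem_ofPred_eq, coe_filter, mem_weights]
    constructor
    · rintro ⟨h1, h2, h3⟩
      exact ⟨h3, h1, by omega⟩
    · rintro ⟨h3, h1, h2⟩
      exact ⟨h1, by omega, h3⟩
  rw [hset, Set.ncard_coe_finset] at h
  omega

/-- The Assmus–Mattson theorem: the number of codewords of given weight vanishing on a set of at
most `t` points depends only on the size of this set. -/
theorem AssmusMattson.vanishCount_eq {C : BinaryCode n} {d' t : ℕ} (hC : C.AssmusMattson d' t)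
    {S S' : Finset (Fin n)} (hS : #S = #S') (hSt : #S ≤ t) (u : ℕ) :
    C.vanishCount u S = C.vanishCount u S' := by
  have hcard := hC.card_filter_weights
  -- The interval adds the at most t - #S weights above n - t that a word vanishing on S can have,
  -- so the total is at most d' - #S.
  refine vanishCount_eq_of_card_le hC.dual_minDist hS
    ({u ∈ C.weights | 0 < u ∧ u + t ≤ n} ∪ Ioc (n - t) (n - #S)) ?_ ?_ u
  · have h1 := card_union_le {u ∈ C.weights | 0 < u ∧ u + t ≤ n} (Ioc (n - t) (n - #S))
    rw [Nat.card_Ioc] at h1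
    omega
  · intro v hv
    rw [mem_union, mem_filter, mem_Ioc, not_or] at hv
    rcases Nat.eq_zero_or_pos v with rfl | hv0
    · rw [vanishCount_zero, vanishCount_zero]
    by_cases hvn : n < v + #S
    · rw [vanishCount_eq_zero_of_lt hvn, vanishCount_eq_zero_of_lt (hS ▸ hvn)]
    · have : v ∉ C.weights := fun hw => by
        by_cases hvt : v + t ≤ n
        · exact hv.1 ⟨hw, hv0, hvt⟩
        · exact hv.2 ⟨by omega, by omega⟩
      rw [vanishCount_eq_zero_of_notMem _ this, vanishCount_eq_zero_of_notMem _ this]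

theorem hammingNorm_add_one (c : Fin n → ZMod 2) :
    hammingNorm (c + fun _ => 1) + hammingNorm c = n := by
  have h := card_filter_add_card_filter_not (s := (univ : Finset (Fin n))) (fun i => c i = 0)
  rw [card_univ, Fintype.card_fin] at h
  refine Eq.trans ?_ h
  rw [hammingNorm, hammingNorm]
  congr 2
  ext i
  simp only [Pi.add_apply, mem_filter, mem_univ, true_and]
  rcases ZMod.two_eq_zero_or_one (c i) with h | h <;> rw [h] <;> decide

theorem add_one_add_one (c : Fin n → ZMod 2) : c + (fun _ => 1) + (fun _ => 1) = c := by
  ext i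
  simp only [Pi.add_apply]
  rcases ZMod.two_eq_zero_or_one (c i) with h | h <;> rw [h] <;> decide

theorem sub_mem_weights {C : BinaryCode n} (h1 : (fun _ => 1) ∈ C) {u : ℕ} (hu : u ∈ C.weights) :
    n - u ∈ C.weights := by
  obtain ⟨c, hc, rfl⟩ := mem_weights.1 hu
  refine mem_weights.2 ⟨_, C.add_mem hc h1, ?_⟩
  have := hammingNorm_add_one c
  omega

/-- Complementation and inclusion-exclusion. -/
theorem vanishCount_sub {C : BinaryCode n} (h1 : (fun _ => 1) ∈ C) {u : ℕ} (hu : u ≤ n)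
    (S : Finset (Fin n)) :
    C.vanishCount (n - u) S = ∑ R ∈ S.powerset, (-1) ^ #R * C.vanishCount u R := by
  have hcompl : C.vanishCount (n - u) S
      = (#{c ∈ C.words | hammingNorm c = u ∧ ∀ i ∈ S, c i ≠ 0} : ℚ) := by
    rw [vanishCount, Nat.cast_inj]
    have hcond : ∀ a : ZMod 2, a + 1 = 0 ↔ a ≠ 0 := by decide
    have hcond' : ∀ a : ZMod 2, a = 0 → a + 1 ≠ 0 := by decide
    refine card_nbij' (· + fun _ => 1) (· + fun _ => 1) ?_ ?_ ?_ ?_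
    · intro c hc
      simp only [mem_coe, mem_filter, mem_words] at hc ⊢
      have := hammingNorm_add_one c
      exact ⟨C.add_mem hc.1 h1, by omega, fun i hi => hcond' _ (hc.2.2 i hi)⟩
    · intro c hc
      simp only [mem_coe, mem_filter, mem_words] at hc ⊢
      have := hammingNorm_add_one c
      exact ⟨C.add_mem hc.1 h1, by omega, fun i hi => (hcond _).2 (hc.2.2 i hi)⟩
    · exact fun c _ => add_one_add_one c
    · exact fun c _ => add_one_add_one c
  have hind : ∀ c : Fin n → ZMod 2, (if ∀ i ∈ S, c i ≠ 0 then (1 : ℚ) else 0)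
      = ∑ R ∈ S.powerset, (-1) ^ #R * if ∀ i ∈ R, c i = 0 then (1 : ℚ) else 0 := by
    intro c
    have : (if ∀ i ∈ S, c i ≠ 0 then (1 : ℚ) else 0)
        = ∏ i ∈ S, ((-if c i = 0 then (1 : ℚ) else 0) + 1) := by
      rw [prod_congr rfl (g := fun i => if c i ≠ 0 then (1 : ℚ) else 0)
        fun i _ => by by_cases h : c i = 0 <;> simp [h], prod_ite_zero]
      simp
    rw [this, prod_add_one]
    refine sum_congr rfl fun R _ => ?_
    rw [ite_forall_eq_zero, ← prod_const, ← prod_mul_distrib]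
    exact prod_congr rfl fun i _ => by ring
  rw [hcompl, ← filter_filter, ← sum_boole, sum_congr rfl fun c _ => hind c, sum_comm]
  refine sum_congr rfl fun R _ => ?_
  rw [← mul_sum, sum_boole, filter_filter, vanishCount]

/-- In the inclusion-exclusion formula, proper subsets contribute equally by Assmus–Mattson; only
the top term, with its sign, survives. -/
theorem AssmusMattson.vanishCount_sub_sub {C : BinaryCode n} {d' t : ℕ}
    (hC : C.AssmusMattson d' t) {T T' : Finset (Fin n)} (hT : #T = t + 1) (hT' : #T' = t + 1)
    {u : ℕ} (hu : u ≤ n) :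
    C.vanishCount (n - u) T - C.vanishCount (n - u) T'
      = (-1) ^ (t + 1) * (C.vanishCount u T - C.vanishCount u T') := by
  rw [vanishCount_sub hC.one_mem hu, vanishCount_sub hC.one_mem hu,
    sum_powerset_sub_sum_powerset (t := t) _ _ hT hT', hT, hT', mul_sub]
  intro R R' hR hRt
  rw [hC.vanishCount_eq hR hRt, hR]

/-- The complementary weight n - u is too large for a word vanishing on t + 1 points, so the
symmetry gives the claim. -/
theorem AssmusMattson.vanishCount_eq_of_le {C : BinaryCode n} {d' t : ℕ}
    (hC : C.AssmusMattson d' t) {T T' : Finset (Fin n)} (hT : #T = t + 1) (hT' : #T' = t + 1)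
    {u : ℕ} (hu : u ≤ t) : C.vanishCount u T = C.vanishCount u T' := by
  have hn : t + 1 ≤ n := by simpa [hT] using card_le_univ T
  have h := hC.vanishCount_sub_sub hT hT' (u := u) (by omega)
  rw [vanishCount_eq_zero_of_lt (by omega), vanishCount_eq_zero_of_lt (by omega), sub_zero,
    zero_eq_mul] at h
  exact sub_eq_zero.1 (h.resolve_left (by simp))

/-! ### MacWilliams duality for words covering T. -/

/-- The weight enumerator of the codewords of `C` whose support contains `T`. -/
noncomputable def blockPoly (C : BinaryCode n) (T : Finset (Fin n)) : ℚ[X] :=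
  ∑ y ∈ C.words, if ∀ i ∈ T, y i ≠ 0 then X ^ hammingNorm y else 0

theorem ncard_supportDesign (C : BinaryCode n) (m : ℕ) (T : Finset (Fin n)) :
    ({B ∈ C.supportDesign m | T ⊆ B}.ncard : ℚ) = (C.blockPoly T).coeff m := by
  have hset : {B ∈ C.supportDesign m | T ⊆ B}
      = (({y ∈ C.words | (∀ i ∈ T, y i ≠ 0) ∧ m = hammingNorm y}.image supp :
        Finset (Finset (Fin n))) : Set (Finset (Fin n))) := by
    ext B
    simp only [supportDesign, Set.mem_ofPred_eq, coe_image, coe_filter, Set.mem_image, mem_words]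
    constructor
    · rintro ⟨⟨c, hc, hm, rfl⟩, hT⟩
      exact ⟨c, ⟨hc, fun i hi => (mem_filter.1 (hT hi)).2, hm.symm⟩, rfl⟩
    · rintro ⟨c, ⟨hc, hT, hm⟩, rfl⟩
      exact ⟨⟨c, hc, hm.symm, rfl⟩, fun i hi => mem_filter.2 ⟨mem_univ i, hT i hi⟩⟩
  rw [hset, Set.ncard_coe_finset, card_image_of_injective, blockPoly, finsetSum_coeff,
    ← filter_filter, ← sum_boole, sum_filter]
  · refine sum_congr rfl fun y _ => ?_
    split_ifs with h1 h2 <;> simp_all [coeff_X_pow]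
  · intro c c' h
    ext i
    have hi : c i ≠ 0 ↔ c' i ≠ 0 := by
      have := Finset.ext_iff.1 h i
      simpa [supp] using this
    rcases ZMod.two_eq_zero_or_one (c i) with h0 | h0 <;>
      rcases ZMod.two_eq_zero_or_one (c' i) with h0' | h0' <;> simp_all

/-- MacWilliams identity for the words of the dual code whose support contains `T`. -/
theorem card_mul_blockPoly_dual (D : BinaryCode n) (T : Finset (Fin n)) :
    C (#D.words : ℚ) * D.dual.blockPoly T
      = ∑ c ∈ D.words, ∏ i, ((if i ∈ T then 0 else 1) + C (signChar (c i)) * X) := by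
  have hprod : ∀ y : Fin n → ZMod 2,
      ∏ i, (if y i = 0 then if i ∈ T then 0 else 1 else (X : ℚ[X]))
        = if ∀ i ∈ T, y i ≠ 0 then X ^ hammingNorm y else 0 := by
    intro y
    split_ifs with h
    · rw [prod_congr rfl (g := fun i => if y i ≠ 0 then (X : ℚ[X]) else 1), ← prod_filter,
        prod_const, hammingNorm]
      intro i _
      by_cases hy : y i = 0
      · have : i ∉ T := fun hi => h i hi hy
        simp [hy, this]
      · simp [hy]
    · push Not at h
      obtain ⟨i, hi, hy⟩ := h
      exact prod_eq_zero (mem_univ i) (by simp [hi, hy])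
  have hexp : ∀ c : Fin n → ZMod 2,
      ∏ i, ((if i ∈ T then 0 else 1) + C (signChar (c i)) * X)
        = ∑ y : Fin n → ZMod 2, (if ∀ i ∈ T, y i ≠ 0 then X ^ hammingNorm y else 0) *
          C (∏ i, signChar (c i * y i)) := by
    intro c
    have hfac : ∀ i, ((if i ∈ T then 0 else 1) + C (signChar (c i)) * X)
        = ∑ a : ZMod 2, (if a = 0 then if i ∈ T then 0 else 1 else (X : ℚ[X])) *
          C (signChar (c i * a)) := by
      intro i
      rw [show (univ : Finset (ZMod 2)) = {0, 1} from rfl, sum_pair (by decide)]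
      rw [if_pos rfl, if_neg (one_ne_zero : (1 : ZMod 2) ≠ 0), mul_zero, AddChar.map_zero_eq_one,
        map_one, mul_one, mul_one, mul_comm X]
    rw [prod_congr rfl fun i _ => hfac i, prod_univ_sum, Fintype.piFinset_univ]
    refine sum_congr rfl fun y _ => ?_
    rw [prod_mul_distrib, hprod, map_prod]
  rw [sum_congr rfl fun c _ => hexp c, sum_comm]
  simp only [← mul_sum, ← map_sum, sum_words_signChar]
  rw [blockPoly, mul_sum]
  refine sum_subset_zero_on_sdiff (subset_univ _) ?_ ?_
  · intro y hy
    rw [if_neg fun h => (mem_sdiff.1 hy).2 (mem_words.2 h), map_zero, mul_zero]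
  · intro y hy
    rw [if_pos (mem_words.1 hy), mul_comm]

theorem prod_one_add_signChar (c : Fin n → ZMod 2) :
    ∏ i, (1 + C (signChar (c i)) * X) = (1 - X) ^ hammingNorm c * (1 + X) ^ (n - hammingNorm c) := by
  have h := card_filter_add_card_filter_not (s := (univ : Finset (Fin n))) (fun i => c i ≠ 0)
  rw [card_univ, Fintype.card_fin] at h
  have h2 : n - hammingNorm c = #{i | ¬ c i ≠ 0} := by
    rw [hammingNorm]
    omega
  rw [h2, hammingNorm, ← prod_const, ← prod_const,
    ← prod_filter_mul_prod_filter_not univ (fun i => c i ≠ 0)]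
  congr 1 <;> refine prod_congr rfl fun i hi => ?_
  · simp [signChar_apply, (mem_filter.1 hi).2, sub_eq_add_neg]
  · simp [not_not.1 (mem_filter.1 hi).2]

/-- For a sign s, (1 - X²)·sX = X(1 + sX)(s - X), and s - X = 2[s = 1] - (1 + X). Expanding over T
leaves only vanishing conditions on subsets R. -/
theorem one_sub_sq_pow_mul_prod (T : Finset (Fin n)) (c : Fin n → ZMod 2) :
    (1 - X ^ 2) ^ #T * ∏ i, ((if i ∈ T then 0 else 1) + C (signChar (c i)) * X)
      = X ^ #T * ∑ R ∈ T.powerset, 2 ^ #R * (-(1 + X)) ^ (#T - #R) *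
        if ∀ i ∈ R, c i = 0 then (1 - X) ^ hammingNorm c * (1 + X) ^ (n - hammingNorm c) else 0 := by
  have hpow : ∀ q : ℚ[X], q ^ #T = ∏ i, if i ∈ T then q else 1 := by
    intro q
    rw [← prod_filter, prod_const]
    simp
  have hfac : ∀ i, (if i ∈ T then 1 - X ^ 2 else 1) *
      ((if i ∈ T then 0 else 1) + C (signChar (c i)) * X)
      = (if i ∈ T then X else 1) * ((1 + C (signChar (c i)) * X) *
        if i ∈ T then 2 * (if c i = 0 then 1 else 0) + -(1 + X) else 1) := by
    intro i
    by_cases hi : i ∈ T <;> by_cases hc : c i = 0 <;> simp [hi, hc, signChar_apply] <;> ring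
  rw [hpow, hpow, ← prod_mul_distrib, prod_congr rfl fun i _ => hfac i, prod_mul_distrib,
    prod_mul_distrib, prod_one_add_signChar]
  congr 1
  rw [← prod_filter, filter_univ_mem, prod_add, mul_sum]
  refine sum_congr rfl fun R hR => ?_
  rw [prod_mul_distrib, prod_const, prod_const, card_sdiff_of_subset (mem_powerset.1 hR),
    prod_ite_zero, prod_const_one]
  split_ifs <;> ring

/-- The difference of the weight enumerators of the dual words containing two given sets of
`t + 1` points. -/
theorem AssmusMattson.blockPoly_dual_sub {D : BinaryCode n} {d' t : ℕ}
    (hD : D.AssmusMattson d' t) {T T' : Finset (Fin n)} (hT : #T = t + 1) (hT' : #T' = t + 1) :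
    (1 - X ^ 2) ^ (t + 1) * (C (#D.words : ℚ) * (D.dual.blockPoly T - D.dual.blockPoly T'))
      = X ^ (t + 1) * (2 ^ (t + 1) * ∑ u ∈ range (n + 1),
        (D.vanishCount u T - D.vanishCount u T') • ((1 - X) ^ u * (1 + X) ^ (n - u))) := by
  have key : ∀ T : Finset (Fin n), #T = t + 1 →
      (1 - X ^ 2) ^ (t + 1) * (C (#D.words : ℚ) * D.dual.blockPoly T)
      = X ^ (t + 1) * ∑ R ∈ T.powerset, 2 ^ #R * (-(1 + X)) ^ (t + 1 - #R) *
        ∑ u ∈ range (n + 1), D.vanishCount u R • ((1 - X) ^ u * (1 + X) ^ (n - u)) := by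
    intro T hT
    rw [card_mul_blockPoly_dual, mul_sum, ← hT,
      sum_congr rfl fun c _ => one_sub_sq_pow_mul_prod T c, ← mul_sum, sum_comm]
    congr 1
    refine sum_congr rfl fun R _ => ?_
    rw [← mul_sum, sum_vanishCount_smul]
  -- Only R = T and R = T' remain, where the power of -(1 + X) is trivial.
  rw [mul_sub, mul_sub, key T hT, key T' hT', ← mul_sub,
    sum_powerset_sub_sum_powerset (t := t) _ _ hT hT', hT, hT', Nat.sub_self, pow_zero, mul_one,
    ← mul_sub, ← sum_sub_distrib]
  · simp only [sub_smul]
  · intro R R' hR hRt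
    rw [hR]
    congr 1
    exact sum_congr rfl fun u _ => by rw [hD.vanishCount_eq hR hRt]

end BinaryCode

/-! ### Coefficients, and the weights that can carry ε. -/

theorem Polynomial.coeff_one_sub_X_sq_pow_mul (a w r : ℕ) (hr : r < 2) (Q : ℚ[X]) :
    ((1 - X ^ 2) ^ a * Q).coeff (2 * w + r)
      = ∑ i ∈ range (w + 1), (-1) ^ (w - i) * (a.choose (w - i) : ℚ) * Q.coeff (2 * i + r) := by
  have hexp : (1 - X ^ 2 : ℚ[X]) ^ a
      = ∑ j ∈ range (a + 1), C ((-1) ^ j * (a.choose j : ℚ)) * X ^ (2 * j) := by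
    rw [sub_eq_neg_add, add_pow]
    refine sum_congr rfl fun j _ => ?_
    rw [one_pow, mul_one, neg_pow, pow_mul]
    simp only [map_mul, map_pow, map_neg, map_one, map_natCast]
    ring
  have hsum : ((1 - X ^ 2) ^ a * Q).coeff (2 * w + r)
      = ∑ j ∈ range (w + 1), (-1) ^ j * (a.choose j : ℚ) * Q.coeff (2 * (w - j) + r) := by
    rw [hexp, sum_mul, finsetSum_coeff]
    simp only [mul_assoc, coeff_C_mul, coeff_X_pow_mul']
    trans ∑ j ∈ range (a + w + 1), (-1 : ℚ) ^ j * ((a.choose j : ℚ) *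
      if 2 * j ≤ 2 * w + r then Q.coeff (2 * w + r - 2 * j) else 0)
    · simp only [← mul_assoc]
      refine sum_subset (range_subset_range.2 (by omega)) fun j _ hj => ?_
      rw [mem_range, not_lt] at hj
      rw [Nat.choose_eq_zero_of_lt (by omega)]
      simp
    · symm
      refine sum_subset_zero_on_sdiff (range_subset_range.2 (by omega)) ?_ ?_
      · intro j hj
        have hj' := (mem_sdiff.1 hj).2
        rw [mem_range, not_lt] at hj'
        rw [if_neg (by omega), mul_zero, mul_zero]
      · intro j hj
        rw [mem_range] at hj
        rw [if_pos (by omega), show 2 * w + r - 2 * j = 2 * (w - j) + r by omega]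
  rw [hsum, ← sum_flip]
  refine sum_congr rfl fun i hi => ?_
  rw [mem_range] at hi
  rw [show w - (w - i) = i by omega]

theorem Polynomial.coeff_one_sub_X_pow_eq (N k : ℕ) :
    ((1 - X : ℚ[X]) ^ N).coeff k = (-1) ^ k * (N.choose k : ℚ) := by
  have h : (1 - X : ℚ[X]) ^ N = ((1 + X : ℚ[X]) ^ N).comp (C (-1) * X) := by
    simp [sub_eq_add_neg]
  rw [h, comp_C_mul_X_coeff, coeff_one_add_X_pow, mul_comm]

namespace BinaryCode

variable {n : ℕ}

theorem isDesign_supportDesign {C : BinaryCode n} {s m : ℕ}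
    (h : ∀ T T' : Finset (Fin n), #T = s → #T' = s →
      (C.blockPoly T).coeff m = (C.blockPoly T').coeff m) :
    IsDesign s m (C.supportDesign m) := by
  constructor
  · rintro B ⟨c, -, hc, rfl⟩
    exact hc
  · by_cases hT : ∃ T : Finset (Fin n), #T = s
    · obtain ⟨T, hT⟩ := hT
      refine ⟨{B ∈ C.supportDesign m | T ⊆ B}.ncard, fun T' hT' => ?_⟩
      have := h T' T hT' hT
      rw [← ncard_supportDesign, ← ncard_supportDesign] at this
      exact_mod_cast this
    · exact ⟨0, fun T hT' => absurd ⟨T, hT'⟩ hT⟩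

theorem one_sub_sq_pow_ne_zero (k : ℕ) : (1 - X ^ 2 : ℚ[X]) ^ k ≠ 0 := by
  refine pow_ne_zero _ fun h => ?_
  simpa using congrArg (eval 0) h

/-- The weights that may distinguish two sets of `t + 1` points. -/
noncomputable def midWeights (C : BinaryCode n) (t : ℕ) : Finset ℕ :=
  {u ∈ C.weights | t < u ∧ u + t + 1 ≤ n}

theorem AssmusMattson.vanishCount_eq_of_notMem {C : BinaryCode n} {d' t : ℕ}
    (hC : C.AssmusMattson d' t) {T T' : Finset (Fin n)} (hT : #T = t + 1) (hT' : #T' = t + 1)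
    {u : ℕ} (hu : u ∉ C.midWeights t) : C.vanishCount u T = C.vanishCount u T' := by
  by_cases hw : u ∈ C.weights
  · rcases Nat.lt_or_ge t u with h | h
    · have hn : n < u + (t + 1) := by
        by_contra hcon
        exact hu (mem_filter.2 ⟨hw, h, by omega⟩)
      rw [vanishCount_eq_zero_of_lt (by omega), vanishCount_eq_zero_of_lt (by omega)]
    · exact hC.vanishCount_eq_of_le hT hT' h
  · rw [vanishCount_eq_zero_of_notMem _ hw, vanishCount_eq_zero_of_notMem _ hw]

/-- Sets of t + 1 points have d' - (t + 1) vanishing moments, enough to kill ε on this few weights.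
-/
theorem AssmusMattson.blockPoly_eq_of_card_midWeights_lt {C : BinaryCode n} {d' t : ℕ}
    (hC : C.AssmusMattson d' t) (hcard : #(C.midWeights t) + t < d') {T T' : Finset (Fin n)}
    (hT : #T = t + 1) (hT' : #T' = t + 1) : C.dual.blockPoly T = C.dual.blockPoly T' := by
  have h := hC.blockPoly_dual_sub hT hT'
  have heps := vanishCount_eq_of_card_le hC.dual_minDist (hT.trans hT'.symm) (C.midWeights t)
    (by omega) fun u hu => hC.vanishCount_eq_of_notMem hT hT' hu
  simp only [heps, sub_self, zero_smul, sum_const_zero, mul_zero] at h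
  have h' := (mul_eq_zero.1 h).resolve_left (one_sub_sq_pow_ne_zero _)
  exact sub_eq_zero.1 ((mul_eq_zero.1 h').resolve_left (C_ne_zero.2 C.card_words_ne_zero))

theorem AssmusMattson.sum_range_eq_sum_midWeights {C : BinaryCode n} {d' t : ℕ}
    (hC : C.AssmusMattson d' t) {T T' : Finset (Fin n)} (hT : #T = t + 1) (hT' : #T' = t + 1)
    (f : ℕ → ℚ[X]) :
    ∑ u ∈ range (n + 1), (C.vanishCount u T - C.vanishCount u T') • f u
      = ∑ u ∈ C.midWeights t, (C.vanishCount u T - C.vanishCount u T') • f u := by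
  symm
  refine sum_subset (fun u hu => ?_) fun u _ hu => ?_
  · exact mem_range.2 (Nat.lt_succ_of_le (weights_le (mem_filter.1 hu).1))
  · rw [hC.vanishCount_eq_of_notMem hT hT' hu, sub_self, zero_smul]

/-- If no weight is lost, the remaining weights are symmetric and lie between `d` and `n - d`. -/
theorem AssmusMattson.midWeights_spec {C : BinaryCode n} {d d' t : ℕ} (hd : C.HasMinDist d)
    (hC : C.AssmusMattson d' t) (hcard : d' ≤ #(C.midWeights t) + t) :
    #(C.midWeights t) + t = d' ∧ d ∈ C.midWeights t ∧
      (∀ u ∈ C.midWeights t, n - u ∈ C.midWeights t) ∧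
      ∀ u ∈ C.midWeights t, d ≤ u ∧ u ≤ n - d := by
  have h0 := hC.card_filter_weights
  have hsub : C.midWeights t ⊆ {u ∈ C.weights | 0 < u ∧ u + t ≤ n} := fun u hu => by
    obtain ⟨h1, h2, h3⟩ := mem_filter.1 hu
    exact mem_filter.2 ⟨h1, by omega, by omega⟩
  -- The Assmus–Mattson weights number exactly d' - t, so none of them is lost.
  have heq : C.midWeights t = _ := eq_of_subset_of_card_le hsub (by omega)
  have hmin : ∀ u ∈ C.midWeights t, d ≤ u := fun u hu => by
    obtain ⟨h1, h2, h3⟩ := mem_filter.1 hu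
    obtain ⟨c, hc, rfl⟩ := mem_weights.1 h1
    exact hd.2 ⟨c, hc, hammingNorm_pos_iff.1 (by omega), rfl⟩
  have hsymm : ∀ u ∈ C.midWeights t, n - u ∈ C.midWeights t := fun u hu => by
    obtain ⟨h1, h2, h3⟩ := mem_filter.1 hu
    exact mem_filter.2 ⟨sub_mem_weights hC.one_mem h1, by omega, by omega⟩
  refine ⟨by rw [heq, h0], ?_, hsymm, fun u hu => ⟨hmin u hu, ?_⟩⟩
  · have hlt := hC.t_lt
    obtain ⟨v, hv⟩ : (C.midWeights t).Nonempty := card_pos.1 (by omega)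
    have hdv := hmin v hv
    have hv' := (mem_filter.1 hv).2
    obtain ⟨c, hc, hc0, hcd⟩ := hd.1
    rw [heq]
    have : 0 < hammingNorm c := hammingNorm_pos_iff.2 hc0
    exact mem_filter.2 ⟨mem_weights.2 ⟨c, hc, hcd⟩, by omega, by omega⟩
  · have h1 := hmin _ (hsymm u hu)
    have h2 := (mem_filter.1 hu).2
    omega

/-- Reduction of the design property to a coefficient of a polynomial. -/
theorem AssmusMattson.coeff_blockPoly_dual_eq {C : BinaryCode n} {d' t : ℕ}
    (hC : C.AssmusMattson d' t) {T T' : Finset (Fin n)} (hT : #T = t + 1) (hT' : #T' = t + 1)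
    (q : ℚ) (P : ℚ[X]) (k : ℕ) (hk : P.coeff k = 0)
    (hP : ∑ u ∈ C.midWeights t, (C.vanishCount u T - C.vanishCount u T') •
      ((1 - X) ^ u * (1 + X) ^ (n - u)) = (1 - X ^ 2) ^ (t + 1) * (Polynomial.C q * P)) :
    (C.dual.blockPoly T).coeff (k + (t + 1)) = (C.dual.blockPoly T').coeff (k + (t + 1)) := by
  have h := hC.blockPoly_dual_sub hT hT'
  rw [hC.sum_range_eq_sum_midWeights hT hT', hP, mul_left_comm _ ((1 - X ^ 2) ^ (t + 1)),
    mul_left_comm _ ((1 - X ^ 2) ^ (t + 1))] at h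
  have h' := congrArg (fun p => p.coeff (k + (t + 1)))
    (mul_left_cancel₀ (one_sub_sq_pow_ne_zero (t + 1)) h)
  have h2 : (2 : ℚ[X]) ^ (t + 1) = Polynomial.C (2 ^ (t + 1)) := by
    rw [map_pow, map_ofNat]
  simp only [coeff_X_pow_mul, coeff_C_mul, h2, hk, mul_zero, coeff_sub] at h'
  exact sub_eq_zero.1 ((mul_eq_zero.1 h').resolve_left C.card_words_ne_zero)

/-- Extracts the factor (1 - X²)^s that cancels the multiplier in `blockPoly_dual_sub`. -/
theorem pow_mul_pow_eq {d s e f : ℕ} (hs : s ≤ d) (he : e = d + f) :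
    (1 - X : ℚ[X]) ^ d * (1 + X) ^ e = (1 - X ^ 2) ^ s * ((1 - X ^ 2) ^ (d - s) * (1 + X) ^ f) ∧
    (1 - X : ℚ[X]) ^ e * (1 + X) ^ d
      = (1 - X ^ 2) ^ s * ((1 - X ^ 2) ^ (d - s) * (1 - X) ^ f) := by
  have h : (1 - X ^ 2 : ℚ[X]) ^ s * (1 - X ^ 2) ^ (d - s) = (1 - X) ^ d * (1 + X) ^ d := by
    rw [← pow_add, Nat.add_sub_cancel' hs, ← mul_pow]
    ring
  rw [← mul_assoc, ← mul_assoc, h, he, pow_add, pow_add]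
  constructor <;> ring

/-! ### The two weight configurations. -/

/-- The case of two weights. -/
theorem AssmusMattson.isDesign_of_two {C : BinaryCode n} {d : ℕ} (hd : C.HasMinDist d)
    (hC : C.AssmusMattson 4 2) (w : ℕ)
    (h : ∑ i ∈ range (w + 1), (-1 : ℚ) ^ (w - i) * Ring.choose ((d : ℚ) - 3) (w - i) *
      Ring.choose ((n : ℚ) - 2 * d) (2 * i + 1) = 0) :
    IsDesign 3 (2 * w + 4) (C.dual.supportDesign (2 * w + 4)) := by
  refine isDesign_supportDesign fun T T' hT hT' => ?_
  rcases Nat.lt_or_ge (#(C.midWeights 2) + 2) 4 with hlt | hge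
  · rw [hC.blockPoly_eq_of_card_midWeights_lt hlt hT hT']
  obtain ⟨hcard, hdW, hsymm, hbd⟩ := hC.midWeights_spec hd hge
  obtain ⟨-, hd3, hdn⟩ := mem_filter.1 hdW
  have hne : d ≠ n - d := by
    intro heq
    have : C.midWeights 2 ⊆ {d} := fun u hu => mem_singleton.2 (by have := hbd u hu; omega)
    have := card_le_card this
    rw [card_singleton] at this
    omega
  have hle := hbd d hdW
  have hW : C.midWeights 2 = {d, n - d} := by
    symm
    refine eq_of_subset_of_card_le ?_ (by rw [card_pair hne]; omega)
    exact insert_subset_iff.2 ⟨hdW, singleton_subset_iff.2 (hsymm d hdW)⟩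
  have heps := hC.vanishCount_sub_sub hT hT' (u := d) (by omega)
  refine hC.coeff_blockPoly_dual_eq hT hT' (C.vanishCount d T - C.vanishCount d T')
    ((1 - X ^ 2) ^ (d - 3) * ((1 + X) ^ (n - 2 * d) - (1 - X) ^ (n - 2 * d))) (2 * w + 1) ?_ ?_
  -- Odd coefficients of (1+X)^N and -(1-X)^N agree, so the coefficient is twice the assumed sum.
  · rw [coeff_one_sub_X_sq_pow_mul _ _ _ (by norm_num), ← mul_zero (2 : ℚ), ← h, mul_sum]
    refine sum_congr rfl fun i _ => ?_
    rw [coeff_sub, coeff_one_sub_X_pow_eq, coeff_one_add_X_pow,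
      show (d : ℚ) - 3 = ((d - 3 : ℕ) : ℚ) by rw [Nat.cast_sub (by omega)]; norm_num,
      show (n : ℚ) - 2 * d = ((n - 2 * d : ℕ) : ℚ) by rw [Nat.cast_sub (by omega)]; norm_num,
      Ring.choose_natCast, Ring.choose_natCast, pow_succ, pow_mul]
    norm_num
    ring
  · rw [hW, sum_pair hne, heps, show n - (n - d) = d by omega]
    obtain ⟨h1, h2⟩ := pow_mul_pow_eq (d := d) (s := 2 + 1) (e := n - d) (f := n - 2 * d)
      (by omega) (by omega)
    rw [h1, h2, smul_eq_C_mul, smul_eq_C_mul]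
    simp only [map_mul, map_pow, map_neg, map_one]
    ring

/-- The case of three weights. -/
theorem AssmusMattson.isDesign_of_three {C : BinaryCode n} {d d' t : ℕ} (hd : C.HasMinDist d)
    (hC : C.AssmusMattson d' t) (hd' : d' = t + 3) (ht : Odd t) (w : ℕ)
    (h : (∑ i ∈ range (w + 1), (-1 : ℚ) ^ (w - i) * Ring.choose ((d : ℚ) - (t + 1)) (w - i) *
        Ring.choose ((n : ℚ) - 2 * d) (2 * i)) +
      (-1 : ℚ) ^ (w + 1) * Ring.choose ((n : ℚ) / 2 - (t + 1)) w = 0) :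
    IsDesign (t + 1) (2 * w + t + 1) (C.dual.supportDesign (2 * w + t + 1)) := by
  refine isDesign_supportDesign fun T T' hT hT' => ?_
  rcases Nat.lt_or_ge (#(C.midWeights t) + t) d' with hlt | hge
  · rw [hC.blockPoly_eq_of_card_midWeights_lt hlt hT hT']
  obtain ⟨hcard, hdW, hsymm, hbd⟩ := hC.midWeights_spec hd hge
  obtain ⟨-, hd3, hdn⟩ := mem_filter.1 hdW
  have hne : d ≠ n - d := by
    intro heq
    have : C.midWeights t ⊆ {d} := fun u hu => mem_singleton.2 (by have := hbd u hu; omega)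
    have := card_le_card this
    rw [card_singleton] at this
    omega
  have hle := hbd d hdW
  have hsub : {d, n - d} ⊆ C.midWeights t :=
    insert_subset_iff.2 ⟨hdW, singleton_subset_iff.2 (hsymm d hdW)⟩
  obtain ⟨v, hv, hvd⟩ : ∃ v ∈ C.midWeights t, v ∉ ({d, n - d} : Finset ℕ) :=
    exists_mem_notMem_of_card_lt_card (by rw [card_pair hne]; omega)
  have hW : C.midWeights t = {v, d, n - d} := by
    symm
    refine eq_of_subset_of_card_le (insert_subset_iff.2 ⟨hv, hsub⟩) ?_
    rw [card_insert_of_notMem hvd, card_pair hne]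
    omega
  have hvle := hbd v hv
  -- The third weight must be its own complement.
  have hn : n = 2 * v := by
    have h1 := hsymm v hv
    rw [hW] at h1
    simp only [mem_insert, mem_singleton] at h1 hvd
    omega
  set ε : ℕ → ℚ := fun u => C.vanishCount u T - C.vanishCount u T' with hε
  have heps : ε (n - d) = ε d := by
    have := hC.vanishCount_sub_sub hT hT' (u := d) (by omega)
    rwa [ht.add_one.neg_one_pow, one_mul] at this
  have hmom := sum_vanishCount_sub_mul_pow hC.dual_minDist (hT.trans hT'.symm) (k := 0) (by omega)
  -- The zeroth moment: ε_v + ε_d + ε_{n-d} = 0.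
  have hepsv : ε v = -2 * ε d := by
    have h1 := hC.sum_range_eq_sum_midWeights hT hT' (fun _ => 1)
    rw [← sum_smul] at h1
    simp only [pow_zero, mul_one] at hmom
    rw [hmom, zero_smul, ← sum_smul, smul_eq_C_mul, mul_one, eq_comm, map_eq_zero_iff _ C_injective,
      hW, sum_insert hvd, sum_pair hne] at h1
    change ε v + (ε d + ε (n - d)) = 0 at h1
    linarith
  rw [show 2 * w + t + 1 = 2 * w + 0 + (t + 1) by ring]
  refine hC.coeff_blockPoly_dual_eq hT hT' (ε d)
    ((1 - X ^ 2) ^ (d - (t + 1)) * ((1 + X) ^ (n - 2 * d) + (1 - X) ^ (n - 2 * d))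
      - Polynomial.C 2 * ((1 - X ^ 2) ^ (v - (t + 1)) * 1)) (2 * w + 0) ?_ ?_
  · have hv2 : ((1 - X ^ 2 : ℚ[X]) ^ (v - (t + 1)) * 1).coeff (2 * w + 0)
        = (-1) ^ w * ((v - (t + 1)).choose w : ℚ) := by
      -- The middle weight leaves no factor beyond a power of 1 - X², hence the single binomial in
      -- n/2.
      rw [coeff_one_sub_X_sq_pow_mul _ _ _ (by norm_num), sum_eq_single_of_mem 0 (by simp)]
      · simp
      · intro i _ hi
        rw [coeff_one, if_neg (by omega), mul_zero]
    rw [coeff_sub, coeff_C_mul, hv2, coeff_one_sub_X_sq_pow_mul _ _ _ (by norm_num),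
      ← mul_zero (2 : ℚ), ← h, mul_add, mul_sum, sub_eq_add_neg]
    congr 1
    · refine sum_congr rfl fun i _ => ?_
      rw [coeff_add, coeff_one_sub_X_pow_eq, coeff_one_add_X_pow,
        show (d : ℚ) - (t + 1) = ((d - (t + 1) : ℕ) : ℚ) by
          rw [Nat.cast_sub (by omega)]; norm_num,
        show (n : ℚ) - 2 * d = ((n - 2 * d : ℕ) : ℚ) by rw [Nat.cast_sub (by omega)]; norm_num,
        Ring.choose_natCast, Ring.choose_natCast, add_zero, pow_mul]
      norm_num
      ring
    · rw [show (n : ℚ) / 2 - (t + 1) = ((v - (t + 1) : ℕ) : ℚ) by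
          rw [Nat.cast_sub (by omega), hn]; push_cast; ring,
        Ring.choose_natCast]
      ring
  · change ∑ u ∈ C.midWeights t, ε u • _ = _
    rw [hW, sum_insert hvd, sum_pair hne, heps, hepsv, show n - (n - d) = d by omega,
      show n - v = v by omega]
    obtain ⟨h1, h2⟩ := pow_mul_pow_eq (d := d) (s := t + 1) (e := n - d) (f := n - 2 * d)
      (by omega) (by omega)
    obtain ⟨h3, -⟩ := pow_mul_pow_eq (d := v) (s := t + 1) (e := v) (f := 0) (by omega) rfl
    rw [h1, h2, h3, smul_eq_C_mul, smul_eq_C_mul, smul_eq_C_mul]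
    simp only [map_mul, map_neg]
    ring

end BinaryCode

end

/-- `Ring.choose x j` is the binomial coefficient `x (x - 1) ⋯ (x - j + 1) / j!` over `ℚ`. -/
theorem theorem1p2 (n d : ℕ) (C : BinaryCode n) (hd : C.HasMinDist d) :
    (C.AssmusMattson 4 2 → ∀ w : ℕ,
      ∑ i ∈ Finset.range (w + 1), (-1 : ℚ) ^ (w - i) * Ring.choose ((d : ℚ) - 3) (w - i) *
          Ring.choose ((n : ℚ) - 2 * d) (2 * i + 1) = 0 →
      IsDesign 3 (2 * w + 4) (C.dual.supportDesign (2 * w + 4))) ∧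
    (∀ dperp t : ℕ, (dperp, t) = (4, 1) ∨ (dperp, t) = (6, 3) →
      C.AssmusMattson dperp t → ∀ w : ℕ,
      (∑ i ∈ Finset.range (w + 1), (-1 : ℚ) ^ (w - i) *
            Ring.choose ((d : ℚ) - (t + 1)) (w - i) * Ring.choose ((n : ℚ) - 2 * d) (2 * i)) +
          (-1 : ℚ) ^ (w + 1) * Ring.choose ((n : ℚ) / 2 - (t + 1)) w = 0 →
      IsDesign (t + 1) (2 * w + t + 1) (C.dual.supportDesign (2 * w + t + 1))) := by
  refine ⟨fun hC w h => hC.isDesign_of_two hd w h, fun dperp t hdt hC w h => ?_⟩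
  rcases hdt with hdt | hdt <;> obtain ⟨rfl, rfl⟩ := Prod.mk.inj hdt
  · exact hC.isDesign_of_three hd rfl (by decide) w h
  · exact hC.isDesign_of_three hd rfl (by decide) w h
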